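/- For an integral domain $D$ with quotient field $K$ and a nonzero $D$-submodule $E$ of $K$ put $E^{-1}:=\{z\in K : zE\subseteq D\}$, $E^{v}:=(E^{-1})^{-1}$, and let $E^{t}$ be the union of all $F^{v}$, where $F$ ranges over the nonzero finitely generated $D$-submodules of $E$. The domain $D$ is called a Prüfer $v$-multiplication domain (P$v$MD) if $(II^{-1})^{t}=D^{t}$ for every nonzero finitely generated $D$-submodule $I$ of $K$. Let $K\subseteq L$ be an algebraic field extension, let $T$ be an integral domain with quotient field $L$, and set $D:=T\cap K$. Assume that $T$ is the integral closure of $D$ in $L$ and that $T$ is a P$v$MD. Then $D$ is a P$v$MD. -/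

import Mathlib

namespace PvMD

section Operations

variable (D : Type*) [CommRing D] {K : Type*} [Field K] [Algebra D K]

/-- `E⁻¹ = (D :_K E) = {z ∈ K | z E ⊆ D}`; here `1 : Submodule D K` is (the image of) `D` in `K`. -/
def inverse (E : Submodule D K) : Submodule D K := 1 / E

/-- The `v`-closure `E^v = (E⁻¹)⁻¹`. -/
def vClosure (E : Submodule D K) : Submodule D K := inverse D (inverse D E)

/-- The `t`-closure `E^t`: the union of the `F^v`, where `F` ranges over the nonzero finitely
generated `D`-submodules of `E`. -/
def tClosure (E : Submodule D K) : Set K :=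
  {x | ∃ F : Submodule D K, F ≠ ⊥ ∧ F.FG ∧ F ≤ E ∧ x ∈ vClosure D F}

/-- `I` is `t`-invertible: `(I I⁻¹)^t = D^t`. -/
def IsTInvertible (I : Submodule D K) : Prop :=
  tClosure D (I * inverse D I) = tClosure D (1 : Submodule D K)

end Operations

/-- A domain `D` is a Prüfer `v`-multiplication domain if every nonzero finitely generated
`D`-submodule of its quotient field is `t`-invertible. -/
def IsPvMD (D : Type*) [CommRing D] [IsDomain D] : Prop :=
  ∀ I : Submodule D (FractionRing D), I ≠ ⊥ → I.FG → IsTInvertible D I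

section Transfer

variable (D : Type*) [CommRing D] {K K' : Type*} [Field K] [Algebra D K] [Field K'] [Algebra D K']

theorem inverse_map (e : K ≃ₐ[D] K') (E : Submodule D K) :
    inverse D (E.map e.toLinearMap) = (inverse D E).map e.toLinearMap := by
  have h := Submodule.map_div (1 : Submodule D K) E e
  have h1 := Submodule.map_one (R := D) e.toAlgHom
  unfold inverse
  refine Eq.trans ?_ h.symm
  congr 1
  exact h1.symm

theorem vClosure_map (e : K ≃ₐ[D] K') (E : Submodule D K) :
    vClosure D (E.map e.toLinearMap) = (vClosure D E).map e.toLinearMap := by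
  simp only [vClosure, inverse_map]

theorem map_symm_map (e : K ≃ₐ[D] K') (E : Submodule D K) :
    (E.map e.toLinearMap).map e.symm.toLinearMap = E := by
  ext x
  simp

theorem map_ne_bot (e : K ≃ₐ[D] K') {E : Submodule D K} (h : E ≠ ⊥) :
    E.map e.toLinearMap ≠ ⊥ := by
  intro h0
  apply h
  rw [← map_symm_map D e E, h0, Submodule.map_bot]

theorem mem_tClosure_map (e : K ≃ₐ[D] K') {E : Submodule D K} {x : K} (hx : x ∈ tClosure D E) :
    e x ∈ tClosure D (E.map e.toLinearMap) := by
  obtain ⟨F, h0, hfg, hle, hm⟩ := hx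
  refine ⟨F.map e.toLinearMap, map_ne_bot D e h0, hfg.map _, Submodule.map_mono hle, ?_⟩
  rw [vClosure_map]
  exact ⟨x, hm, rfl⟩

theorem tClosure_map (e : K ≃ₐ[D] K') (E : Submodule D K) :
    tClosure D (E.map e.toLinearMap) = e '' tClosure D E := by
  ext y
  constructor
  · intro hy
    have h := mem_tClosure_map D e.symm hy
    rw [map_symm_map] at h
    exact ⟨e.symm y, h, e.apply_symm_apply y⟩
  · rintro ⟨x, hx, rfl⟩
    exact mem_tClosure_map D e hx

theorem IsTInvertible.map (e : K ≃ₐ[D] K') {I : Submodule D K} (h : IsTInvertible D I) :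
    IsTInvertible D (I.map e.toLinearMap) := by
  have h1 : (1 : Submodule D K').map LinearMap.id = (1 : Submodule D K).map e.toLinearMap := by
    rw [Submodule.map_id]
    exact (Submodule.map_one (R := D) e.toAlgHom).symm
  rw [Submodule.map_id] at h1
  have h2 : I.map e.toLinearMap * (inverse D I).map e.toLinearMap
      = (I * inverse D I).map e.toLinearMap :=
    (Submodule.map_mul I (inverse D I) e.toAlgHom).symm
  unfold IsTInvertible at h ⊢
  rw [inverse_map, h2, h1, tClosure_map, tClosure_map, h]

/-- The property does not depend on the chosen model `K` of the quotient field. -/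
theorem isPvMD_iff (K : Type*) [Field K] [IsDomain D] [Algebra D K] [IsFractionRing D K] :
    IsPvMD D ↔ ∀ I : Submodule D K, I ≠ ⊥ → I.FG → IsTInvertible D I := by
  let e : FractionRing D ≃ₐ[D] K := FractionRing.algEquiv D K
  constructor
  · intro h I h0 hfg
    have := (h (I.map e.symm.toLinearMap) (map_ne_bot D e.symm h0) (hfg.map _)).map D e
    have h2 := map_symm_map D e.symm I
    rw [AlgEquiv.symm_symm] at h2
    rwa [h2] at this
  · intro h I h0 hfg
    have := (h (I.map e.toLinearMap) (map_ne_bot D e h0) (hfg.map _)).map D e.symm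
    rwa [map_symm_map] at this

end Transfer

end PvMD

open Polynomial

namespace PvMD

section Content

variable {F : Type*} [Field F]

theorem contentIdeal_eq_top_of_coeff_eq_one {R : Type*} [CommRing R] {p : R[X]} {i : ℕ}
    (h : p.coeff i = 1) : p.contentIdeal = ⊤ :=
  (Ideal.eq_top_iff_one _).2 (h ▸ p.coeff_mem_contentIdeal i)

theorem exists_valuation_coeff_le (V : ValuationSubring F) {f : F[X]} (hf : f ≠ 0) :
    ∃ i, f.coeff i ≠ 0 ∧ ∀ j, V.valuation (f.coeff j) ≤ V.valuation (f.coeff i) := by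
  obtain ⟨i, hi, hmax⟩ := f.support.exists_max_image (fun i => V.valuation (f.coeff i))
    (support_nonempty.2 hf)
  refine ⟨i, mem_support_iff.1 hi, fun j => ?_⟩
  by_cases hj : f.coeff j = 0
  · simp [hj]
  · exact hmax j (mem_support_iff.2 hj)

/-- A nonzero polynomial is a scalar multiple of a polynomial over `V` with a coefficient `1`. -/
theorem exists_primitive_factor (V : ValuationSubring F) {f : F[X]} (hf : f ≠ 0) :
    ∃ (a : F) (p : V[X]), f = C a * p.map V.subtype ∧ p.contentIdeal = ⊤ ∧
      ∀ j, V.valuation (f.coeff j) ≤ V.valuation a := by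
  obtain ⟨i, hi, hmax⟩ := exists_valuation_coeff_le V hf
  have hmem : C (f.coeff i)⁻¹ * f ∈ (mapRingHom V.subtype).range := by
    rw [mem_map_range]
    intro n
    rw [coeff_C_mul]
    refine ⟨⟨(f.coeff i)⁻¹ * f.coeff n, ?_⟩, rfl⟩
    rw [← V.valuation_le_one_iff, map_mul, map_inv₀]
    exact inv_mul_le_one_of_le₀ (hmax n) zero_le
  obtain ⟨p, hp⟩ := hmem
  rw [coe_mapRingHom] at hp
  refine ⟨f.coeff i, p, ?_, ?_, hmax⟩
  · rw [hp, ← mul_assoc, ← C_mul, mul_inv_cancel₀ hi, C_1, one_mul]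
  · refine contentIdeal_eq_top_of_coeff_eq_one (i := i) (Subtype.ext ?_)
    have := congrArg (fun q => coeff q i) hp
    simpa [hi] using this

theorem coeff_mul_coeff_mem_valuationSubring (V : ValuationSubring F) {f g : F[X]}
    (h : ∀ n, (f * g).coeff n ∈ V) (i j : ℕ) : f.coeff i * g.coeff j ∈ V := by
  rcases eq_or_ne f 0 with rfl | hf
  · simp
  rcases eq_or_ne g 0 with rfl | hg
  · simp
  obtain ⟨a, p, hfp, hp, ha⟩ := exists_primitive_factor V hf
  obtain ⟨b, q, hgq, hq, hb⟩ := exists_primitive_factor V hg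
  have hab : V.valuation (a * b) ≤ 1 := by
    by_contra! hlt
    have hle : (p * q).contentIdeal ≤ IsLocalRing.maximalIdeal V := by
      rw [contentIdeal_def, Ideal.span_le]
      intro x hx
      obtain ⟨n, -, rfl⟩ := mem_coeffs_iff.1 hx
      have hn := (V.valuation_le_one_iff _).2 (h n)
      have : (f * g).coeff n = a * b * ((p * q).coeff n : F) := by
        rw [hfp, hgq, mul_mul_mul_comm, ← C_mul, ← Polynomial.map_mul, coeff_C_mul, coeff_map]
        rfl
      rw [this, map_mul] at hn
      rw [SetLike.mem_coe, V.valuation_lt_one_iff]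
      by_contra! hge
      exact absurd hn (not_le.2 (lt_of_lt_of_le hlt (le_mul_of_one_le_right zero_le hge)))
    rw [contentIdeal_mul_eq_top_of_contentIdeal_eq_top hp hq] at hle
    exact (IsLocalRing.maximalIdeal.isMaximal V).ne_top (top_le_iff.1 hle)
  rw [← V.valuation_le_one_iff, map_mul]
  rw [map_mul] at hab
  exact (mul_le_mul' (ha i) (hb j)).trans hab

/-- Kronecker: over an integrally closed subring, products of coefficients of the factors of a
polynomial with coefficients in the subring lie in the subring. -/
theorem coeff_mul_coeff_mem (A : Subring F) [IsIntegrallyClosedIn A F] {f g : F[X]}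
    (h : ∀ n, (f * g).coeff n ∈ A) (i j : ℕ) : f.coeff i * g.coeff j ∈ A := by
  by_contra hx
  obtain ⟨V, hAV, hV⟩ := A.exists_le_valuationSubring_of_isIntegrallyClosedIn hx
  exact hV (coeff_mul_coeff_mem_valuationSubring V (fun n => hAV (h n)) i j)

/-- The coefficients of `g` lie in `A` and generate an `A`-submodule with trivial `v`-closure. -/
def UnitVContent (A : Subring F) (g : F[X]) : Prop :=
  (∀ i, g.coeff i ∈ A) ∧ ∀ z, (∀ i, z * g.coeff i ∈ A) → z ∈ A

theorem coeff_mul_mem {A : Subring F} {f g : F[X]} (hf : ∀ i, f.coeff i ∈ A)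
    (hg : ∀ i, g.coeff i ∈ A) (n : ℕ) : (f * g).coeff n ∈ A := by
  rw [coeff_mul]
  exact sum_mem fun _ _ => mul_mem (hf _) (hg _)

theorem unitVContent_one (A : Subring F) : UnitVContent A 1 := by
  refine ⟨fun i => ?_, fun z h => by simpa using h 0⟩
  rw [coeff_one]
  split_ifs
  exacts [A.one_mem, A.zero_mem]

theorem UnitVContent.mul {A : Subring F} [IsIntegrallyClosedIn A F] {f g : F[X]}
    (hf : UnitVContent A f) (hg : UnitVContent A g) : UnitVContent A (f * g) := by
  refine ⟨coeff_mul_mem hf.1 hg.1, fun z hz => hg.2 z fun j => hf.2 _ fun i => ?_⟩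
  have h : ∀ n, (f * (C z * g)).coeff n ∈ A := fun n => by
    rw [mul_left_comm, coeff_C_mul]
    exact hz n
  have := coeff_mul_coeff_mem A h i j
  rwa [coeff_C_mul, mul_comm] at this

theorem UnitVContent.pow {A : Subring F} [IsIntegrallyClosedIn A F] {f : F[X]}
    (hf : UnitVContent A f) (n : ℕ) : UnitVContent A (f ^ n) := by
  induction n with
  | zero => simpa using unitVContent_one A
  | succ n ih => rw [pow_succ]; exact ih.mul hf

theorem UnitVContent.map_equiv {A : Subring F} (σ : F ≃+* F) (hσ : ∀ x, σ x ∈ A ↔ x ∈ A)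
    {f : F[X]} (hf : UnitVContent A f) : UnitVContent A (f.map (σ : F →+* F)) := by
  refine ⟨fun i => ?_, fun z hz => ?_⟩
  · simpa [hσ] using hf.1 i
  · obtain ⟨w, rfl⟩ := σ.surjective z
    rw [hσ]
    refine hf.2 w fun i => (hσ _).1 ?_
    simpa using hz i

theorem UnitVContent.of_map {E : Type*} [Field E] (φ : E →+* F) {A : Subring F} {f : E[X]}
    (hf : UnitVContent A (f.map φ)) : UnitVContent (A.comap φ) f :=
  ⟨fun i => by simpa using hf.1 i, fun z hz => hf.2 (φ z) fun i => by simpa using hz i⟩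

end Content

end PvMD

namespace PvMD

section Ascent

variable {L Ω : Type*} [Field L] [Field Ω] [Algebra L Ω]

theorem isIntegrallyClosedIn_comap (B : Subring Ω) [IsIntegrallyClosedIn B Ω] :
    IsIntegrallyClosedIn (B.comap (algebraMap L Ω)) L := by
  rw [Subring.isIntegrallyClosedIn_iff]
  intro x hx
  let φ : B.comap (algebraMap L Ω) →+* B :=
    ((algebraMap L Ω).comp (Subring.subtype _)).codRestrict B fun x => x.2
  exact Subring.mem_comap.2 <| Subring.isIntegrallyClosedIn_iff.1 ‹IsIntegrallyClosedIn B Ω›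
    (IsIntegral.map_of_comp_eq φ (algebraMap L Ω) (by ext; rfl) hx)

theorem esymm_mul_pow_mem {R : Type*} [CommRing R] (S : Subring R[X]) (s : Multiset R) (G : R[X])
    (h : ∀ r ∈ s, C r * G ∈ S) (m : ℕ) : C (s.esymm m) * G ^ m ∈ S := by
  rw [Multiset.esymm, map_multiset_sum, ← Multiset.sum_map_mul_right, Multiset.map_map]
  refine multiset_sum_mem _ fun x hx => ?_
  obtain ⟨u, hu, rfl⟩ := Multiset.mem_map.1 hx
  obtain ⟨hus, rfl⟩ := Multiset.mem_powersetCard.1 hu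
  have : C u.prod * G ^ Multiset.card u = (u.map fun r => C r * G).prod := by
    rw [Multiset.prod_map_mul, Multiset.map_const', Multiset.prod_replicate,
      map_multiset_prod]
  rw [Function.comp_apply, this]
  refine multiset_prod_mem _ fun x hx => ?_
  obtain ⟨r, hr, rfl⟩ := Multiset.mem_map.1 hx
  exact h r (Multiset.mem_of_le hus hr)

/-- Trivial `v`-content is inherited by integrally closed subrings of normal field extensions that
are stable under automorphisms. -/
theorem UnitVContent.map_algebraMap [Normal L Ω] {B : Subring Ω} [IsIntegrallyClosedIn B Ω]
    (hB : ∀ (σ : Ω ≃ₐ[L] Ω) (x : Ω), x ∈ B → σ x ∈ B) {g : L[X]}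
    (hg : UnitVContent (B.comap (algebraMap L Ω)) g) :
    UnitVContent B (g.map (algebraMap L Ω)) := by
  refine ⟨fun i => by simpa using hg.1 i, fun z hz => ?_⟩
  have : IsIntegrallyClosedIn (B.comap (algebraMap L Ω)) L := isIntegrallyClosedIn_comap B
  set p := (minpoly L z).map (algebraMap L Ω) with hp
  have hzint : IsIntegral L z := Normal.isIntegral ‹_› z
  have hmonic : p.Monic := (minpoly.monic hzint).map _
  have hroot : ∀ r ∈ p.roots, ∀ i, r * algebraMap L Ω (g.coeff i) ∈ B := by
    intro r hr i
    have hconj : IsConjRoot L r z := by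
      rw [isConjRoot_def, ← minpoly.eq_of_irreducible_of_monic (minpoly.irreducible hzint) _
        (minpoly.monic hzint)]
      rw [mem_roots hmonic.ne_zero, hp, IsRoot.def, eval_map_algebraMap] at hr
      exact hr
    obtain ⟨σ, rfl⟩ := isConjRoot_iff_exists_algEquiv.1 hconj
    have := hB σ _ (hz i)
    simpa using this
  have hesymm : ∀ m, ∀ n, (C (p.roots.esymm m) * (g.map (algebraMap L Ω)) ^ m).coeff n ∈ B := by
    intro m n
    have := esymm_mul_pow_mem (mapRingHom B.subtype).range p.roots (g.map (algebraMap L Ω))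
      (fun r hr => by
        rw [mem_map_range]
        intro i
        simpa using hroot r hr i) m
    simpa using mem_map_range _ |>.1 this n
  have hcoeff : ∀ k, p.coeff k ∈ B := by
    intro k
    rcases le_or_gt k p.natDegree with hk | hk
    · have hk' := coeff_eq_esymm_roots_of_splits (Normal.splits ‹Normal L Ω› z) hk
      rw [← hp, hmonic.leadingCoeff, one_mul] at hk'
      rw [hp, coeff_map]
      refine (hg.pow (p.natDegree - k)).2 ((minpoly L z).coeff k) fun n => ?_
      rw [Subring.mem_comap, map_mul, ← coeff_map, ← hp, hk', mul_assoc]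
      refine mul_mem (pow_mem (neg_mem B.one_mem) _) ?_
      simpa [← coeff_map] using hesymm (p.natDegree - k) n
    · rw [coeff_eq_zero_of_natDegree_lt hk]
      exact B.zero_mem
  refine Subring.isIntegrallyClosedIn_iff.1 ‹IsIntegrallyClosedIn B Ω› ?_
  refine IsIntegral.of_aeval_monic_of_isIntegral_coeff hmonic ?_ ?_ fun i =>
    isIntegral_algebraMap (R := B) (x := ⟨_, hcoeff i⟩)
  · rw [hp, natDegree_map]
    exact (minpoly.natDegree_pos hzint).ne'
  · rw [hp, eval_map_algebraMap, minpoly.aeval]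
    exact isIntegral_zero

end Ascent

end PvMD

namespace PvMD

section Norm

variable {K : Type*} [Field K]

theorem exists_pow_mem_range_of_fixed {N : Type*} [Field N] [Algebra K N] [Normal K N] (q : ℕ)
    [ExpChar K q] {c : N} (hc : ∀ σ : N ≃ₐ[K] N, σ c = c) :
    ∃ n : ℕ, c ^ q ^ n ∈ (algebraMap K N).range := by
  classical
  rw [← minpoly.natSepDegree_eq_one_iff_pow_mem,
    natSepDegree_eq_of_splits (E := N) _ (Normal.splits ‹_› c), Finset.card_eq_one]
  have hint : IsIntegral K c := Normal.isIntegral ‹_› c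
  refine ⟨c, Finset.ext fun x => ?_⟩
  rw [Multiset.mem_toFinset, mem_aroots, Finset.mem_singleton]
  constructor
  · rintro ⟨-, hx⟩
    have hconj : IsConjRoot K x c := by
      rw [isConjRoot_def, ← minpoly.eq_of_irreducible_of_monic (minpoly.irreducible hint) hx
        (minpoly.monic hint)]
    obtain ⟨σ, rfl⟩ := isConjRoot_iff_exists_algEquiv.1 hconj
    exact hc σ
  · rintro rfl
    exact ⟨minpoly.ne_zero hint, minpoly.aeval _ _⟩

theorem exists_pow_mem_lifts_of_fixed {N : Type*} [Field N] [Algebra K N] [Normal K N]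
    {h : N[X]} (hh : ∀ σ : N ≃ₐ[K] N, h.map (σ : N →+* N) = h) :
    ∃ q ≠ 0, ∃ p : K[X], p.map (algebraMap K N) = h ^ q := by
  obtain ⟨q, hq⟩ := ExpChar.exists K
  have : ExpChar N q := expChar_of_injective_algebraMap (algebraMap K N).injective q
  have hfix : ∀ i, ∃ n : ℕ, h.coeff i ^ q ^ n ∈ (algebraMap K N).range := fun i =>
    exists_pow_mem_range_of_fixed q fun σ => by
      conv_rhs => rw [← hh σ]
      simp
  choose n hn using hfix
  let m := h.support.sup n
  have hm : ∀ i, h.coeff i ^ q ^ m ∈ (algebraMap K N).range := by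
    intro i
    by_cases hi : i ∈ h.support
    · obtain ⟨k, hk⟩ := Nat.exists_eq_add_of_le (Finset.le_sup (f := n) hi)
      change _ ^ q ^ (h.support.sup n) ∈ _
      rw [hk, pow_add, pow_mul]
      exact pow_mem (hn i) _
    · rw [notMem_support_iff.1 hi, zero_pow (pow_pos (expChar_pos K q) m).ne']
      exact zero_mem _
  refine ⟨q ^ m, (pow_pos (expChar_pos K q) m).ne', ?_⟩
  have : ExpChar N[X] q := expChar_of_injective_algebraMap (C_injective (R := N)) q
  have hmem : h ^ q ^ m ∈ (mapRingHom (algebraMap K N)).range := by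
    rw [← map_iterateFrobenius_expand, mem_map_range]
    intro i
    rw [coeff_map, coeff_expand (pow_pos (expChar_pos K q) m)]
    split_ifs
    · simpa [iterateFrobenius_def] using hm _
    · simp
  exact hmem

/-- A power of the product of the conjugates of a polynomial has coefficients in the base field. -/
theorem exists_norm {Ω : Type*} [Field Ω] [Algebra K Ω] [Normal K Ω] (g : Polynomial Ω) :
    ∃ s : Multiset (Ω ≃ₐ[K] Ω), g ∈ s.map (fun σ : Ω ≃ₐ[K] Ω => g.map (σ : Ω →+* Ω)) ∧
      ∃ q ≠ 0, ∃ p : K[X], p.map (algebraMap K Ω) =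
        (s.map fun σ : Ω ≃ₐ[K] Ω => g.map (σ : Ω →+* Ω)).prod ^ q := by
  let E := IntermediateField.adjoin K (g.coeffs : Set Ω)
  have : FiniteDimensional K E := IntermediateField.finiteDimensional_adjoin
    fun x _ => Normal.isIntegral ‹_› x
  let N := IntermediateField.normalClosure K E Ω
  obtain ⟨gN, hgN⟩ : g ∈ (mapRingHom (algebraMap N Ω)).range := by
    rw [mem_map_range]
    intro i
    by_cases hi : g.coeff i = 0
    · rw [hi]; exact zero_mem _
    · exact ⟨⟨g.coeff i, E.le_normalClosure
        (IntermediateField.subset_adjoin K _ (coeff_mem_coeffs hi))⟩, rfl⟩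
  rw [coe_mapRingHom] at hgN
  have hlift : ∀ τ : N ≃ₐ[K] N, (gN.map (τ : N →+* N)).map (algebraMap N Ω) =
      g.map (τ.liftNormal Ω : Ω →+* Ω) := fun τ => by
    ext i
    simp only [coeff_map, ← hgN]
    exact (AlgEquiv.liftNormal_commutes τ Ω _).symm
  refine ⟨Finset.univ.val.map fun τ : N ≃ₐ[K] N => τ.liftNormal Ω, ?_, ?_⟩
  · rw [Multiset.map_map, Multiset.mem_map]
    refine ⟨1, Finset.mem_univ _, (hlift 1).symm.trans ?_⟩
    rw [← hgN]
    congr 1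
    exact Polynomial.map_id
  · obtain ⟨q, hq, p, hp⟩ := exists_pow_mem_lifts_of_fixed (K := K)
      (h := ∏ τ : N ≃ₐ[K] N, gN.map (τ : N →+* N)) (fun σ => by
        rw [Polynomial.map_prod]
        refine Fintype.prod_equiv (Equiv.mulLeft σ) _ _ fun τ => ?_
        rw [Polynomial.map_map]
        rfl)
    refine ⟨q, hq, p, ?_⟩
    rw [IsScalarTower.algebraMap_eq K N Ω, ← Polynomial.map_map, hp, Polynomial.map_pow,
      Polynomial.map_prod, Multiset.map_map]
    simp only [hlift]
    rfl

end Norm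

end PvMD

namespace PvMD

section TInvertible

variable {F : Type*} [Field F] (A : Subring F)

/-- The submodule generated by the coefficients of a polynomial. -/
def coeffSpan (f : F[X]) : Submodule A F := Submodule.span A (Set.range f.coeff)

variable {A}

theorem mem_one_iff {x : F} : x ∈ (1 : Submodule A F) ↔ x ∈ A := by
  rw [Submodule.mem_one]
  exact ⟨fun ⟨y, hy⟩ => hy ▸ y.2, fun hx => ⟨⟨x, hx⟩, rfl⟩⟩

theorem mem_inverse_iff {E : Submodule A F} {z : F} :
    z ∈ inverse A E ↔ ∀ y ∈ E, z * y ∈ A := by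
  simp only [inverse, Submodule.mem_div_iff_forall_mul_mem, mem_one_iff]

theorem coeff_mem_coeffSpan (f : F[X]) (i : ℕ) : f.coeff i ∈ coeffSpan A f :=
  Submodule.subset_span ⟨i, rfl⟩

theorem coeffSpan_le {f : F[X]} {E : Submodule A F} :
    coeffSpan A f ≤ E ↔ ∀ i, f.coeff i ∈ E :=
  Submodule.span_le.trans Set.range_subset_iff

theorem mem_inverse_coeffSpan {f : F[X]} {z : F} :
    z ∈ inverse A (coeffSpan A f) ↔ ∀ i, z * f.coeff i ∈ A := by
  refine ⟨fun h i => mem_inverse_iff.1 h _ (coeff_mem_coeffSpan f i), fun h => ?_⟩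
  rw [mem_inverse_iff]
  intro y hy
  induction hy using Submodule.span_induction with
  | mem x hx => obtain ⟨i, rfl⟩ := hx; exact h i
  | zero => simp
  | add x y _ _ hx hy => rw [mul_add]; exact add_mem hx hy
  | smul a x _ hx => rw [mul_smul_comm]; exact mul_mem a.2 hx

theorem exists_coeffSpan_eq {E : Submodule A F} (hE : E.FG) : ∃ f : F[X], coeffSpan A f = E := by
  obtain ⟨n, s, rfl⟩ := Submodule.fg_iff_exists_fin_generating_family.1 hE
  classical
  refine ⟨ofFn n s, le_antisymm (coeffSpan_le.2 fun i => ?_) (Submodule.span_le.2 ?_)⟩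
  · rcases lt_or_ge i n with hi | hi
    · rw [ofFn_coeff_eq_val_of_lt s hi]
      exact Submodule.subset_span ⟨_, rfl⟩
    · rw [ofFn_coeff_eq_zero_of_ge s hi]
      exact zero_mem _
  · rintro _ ⟨i, rfl⟩
    rw [← ofFn_coeff_eq_val_of_lt s i.2]
    exact coeff_mem_coeffSpan _ _

theorem coeffSpan_fg (f : F[X]) : (coeffSpan A f).FG := by
  classical
  refine Submodule.fg_span ((insert 0 f.coeffs).finite_toSet.subset ?_)
  rintro _ ⟨i, rfl⟩
  by_cases hi : f.coeff i = 0
  · simp [hi]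
  · simp [coeff_mem_coeffs hi]

theorem coeffSpan_ne_bot {f : F[X]} : coeffSpan A f ≠ ⊥ ↔ f ≠ 0 := by
  rw [not_iff_not, eq_bot_iff, coeffSpan_le]
  exact ⟨fun h => Polynomial.ext fun i => by simpa using h i, fun h i => by simp [h]⟩

theorem exists_fg_le_mul {R M : Type*} [CommRing R] [CommRing M] [Algebra R M]
    {E I J : Submodule R M} (hE : E.FG) (hle : E ≤ I * J) :
    ∃ J' ≤ J, J'.FG ∧ E ≤ I * J' := by
  classical
  obtain ⟨S, rfl⟩ := hE
  have key : ∀ x : S, ∃ t : Finset M, (t : Set M) ⊆ J ∧ (x : M) ∈ I * Submodule.span R t := by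
    intro x
    obtain ⟨t, t', ht, ht', hx⟩ :=
      Submodule.mem_span_mul_finite_of_mem_mul (hle (Submodule.subset_span x.2))
    refine ⟨t', ht', ?_⟩
    rw [← Submodule.span_mul_span] at hx
    exact mul_le_mul' (Submodule.span_le.2 ht) le_rfl hx
  choose t ht hmem using key
  refine ⟨Submodule.span R (Finset.univ.biUnion t : Finset M), Submodule.span_le.2 ?_,
    ⟨_, rfl⟩, Submodule.span_le.2 fun x hx => ?_⟩
  · intro y hy
    obtain ⟨x, -, hy⟩ := Finset.mem_biUnion.1 hy
    exact ht x hy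
  · refine mul_le_mul' le_rfl (Submodule.span_mono ?_) (hmem ⟨x, hx⟩)
    exact Finset.coe_subset.2 (Finset.subset_biUnion_of_mem t (Finset.mem_univ _))

theorem mul_inverse_le (I : Submodule A F) : I * inverse A I ≤ 1 := by
  rw [Submodule.mul_le]
  intro x hx y hy
  rw [mem_one_iff, mul_comm]
  exact mem_inverse_iff.1 hy x hx

theorem one_mem_vClosure_iff {E : Submodule A F} :
    1 ∈ vClosure A E ↔ ∀ z ∈ inverse A E, z ∈ A := by
  rw [vClosure, mem_inverse_iff]
  simp

theorem one_mem_tClosure_one : (1 : F) ∈ tClosure A (1 : Submodule A F) := by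
  refine ⟨1, ?_, ⟨{1}, by rw [Finset.coe_singleton]; exact Submodule.one_eq_span.symm⟩, le_rfl, ?_⟩
  · exact fun h => one_ne_zero ((Submodule.mem_bot A).1 (h ▸ mem_one_iff.2 A.one_mem))
  · rw [one_mem_vClosure_iff]
    intro z hz
    simpa using mem_inverse_iff.1 hz 1 (mem_one_iff.2 A.one_mem)

theorem tClosure_mono {E E' : Submodule A F} (h : E ≤ E') : tClosure A E ⊆ tClosure A E' :=
  fun _ ⟨G, h0, hfg, hle, hx⟩ => ⟨G, h0, hfg, hle.trans h, hx⟩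

theorem mem_of_mem_tClosure_one {x : F} (hx : x ∈ tClosure A (1 : Submodule A F)) : x ∈ A := by
  obtain ⟨G, -, -, hle, hx⟩ := hx
  have h1 : (1 : F) ∈ inverse A G := mem_inverse_iff.2 fun y hy => by
    rw [one_mul]
    exact mem_one_iff.1 (hle hy)
  simpa using mem_inverse_iff.1 hx 1 h1

theorem IsTInvertible.exists_unitVContent [IsIntegrallyClosedIn A F] {f : F[X]}
    (hf : IsTInvertible A (coeffSpan A f)) :
    ∃ h : F[X], h ≠ 0 ∧ UnitVContent A (f * h) := by
  have h1 : (1 : F) ∈ tClosure A (coeffSpan A f * inverse A (coeffSpan A f)) :=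
    hf.symm ▸ one_mem_tClosure_one
  obtain ⟨G, hG0, hGfg, hGle, hG⟩ := h1
  obtain ⟨J, hJ, hJfg, hGJ⟩ := exists_fg_le_mul hGfg hGle
  obtain ⟨h, rfl⟩ := exists_coeffSpan_eq hJfg
  refine ⟨h, ?_, fun n => ?_, fun z hz => ?_⟩
  · rintro rfl
    have hb : coeffSpan A (0 : F[X]) = ⊥ := not_not.1 (mt coeffSpan_ne_bot.1 (by simp))
    rw [hb, Submodule.mul_bot] at hGJ
    exact hG0 (le_bot_iff.1 hGJ)
  · rw [coeff_mul]
    refine sum_mem fun x _ => ?_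
    rw [mul_comm]
    exact mem_inverse_iff.1 (coeffSpan_le.1 hJ _) _ (coeff_mem_coeffSpan _ _)
  · refine one_mem_vClosure_iff.1 hG z (mem_inverse_iff.2 fun y hy => ?_)
    have hfh : ∀ n, (f * (C z * h)).coeff n ∈ A := fun n => by
      rw [mul_left_comm, coeff_C_mul]
      exact hz n
    have hle : coeffSpan A f * coeffSpan A h ≤ inverse A (Submodule.span A {z}) := by
      rw [coeffSpan, coeffSpan, Submodule.span_mul_span, Submodule.span_le]
      rintro _ ⟨_, ⟨i, rfl⟩, _, ⟨j, rfl⟩, rfl⟩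
      rw [SetLike.mem_coe, mem_inverse_iff]
      intro w hw
      obtain ⟨a, rfl⟩ := Submodule.mem_span_singleton.1 hw
      have := coeff_mul_coeff_mem A hfh i j
      rw [coeff_C_mul] at this
      rw [mul_smul_comm]
      refine mul_mem a.2 ?_
      convert this using 1
      ring
    rw [mul_comm]
    exact mem_inverse_iff.1 (hle (hGJ hy)) z (Submodule.mem_span_singleton_self z)

theorem UnitVContent.isTInvertible [IsIntegrallyClosedIn A F] {f h : F[X]} (h0 : f * h ≠ 0)
    (hfh : UnitVContent A (f * h)) : IsTInvertible A (coeffSpan A f) := by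
  refine (tClosure_mono (mul_inverse_le _)).antisymm fun x hx => ?_
  refine ⟨coeffSpan A (f * h), coeffSpan_ne_bot.2 h0, coeffSpan_fg _, coeffSpan_le.2 fun n => ?_,
    mem_inverse_iff.2 fun y hy => mul_mem (mem_of_mem_tClosure_one hx)
      (hfh.2 y (mem_inverse_coeffSpan.1 hy))⟩
  rw [coeff_mul]
  refine sum_mem fun ij _ => Submodule.mul_mem_mul (coeff_mem_coeffSpan _ _) ?_
  rw [mem_inverse_coeffSpan]
  intro i
  rw [mul_comm]
  exact coeff_mul_coeff_mem A hfh.1 i _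

end TInvertible

end PvMD

namespace PvMD

section Descent

variable {K L : Type*} [Field K] [Field L] [Algebra K L]

theorem isFractionRing_comap (D : Subring K) (T : Subring L) [IsFractionRing T L]
    (hD : D = T.comap (algebraMap K L)) (hT : ∀ x : L, x ∈ T ↔ IsIntegral D x) :
    IsFractionRing D K := by
  refine IsFractionRing.of_field D K fun x => ?_
  obtain ⟨a, s, hs, hx⟩ := IsFractionRing.div_surjective (A := T) (algebraMap K L x)
  have hs0 : (s : L) ≠ 0 := fun h => nonZeroDivisors.ne_zero hs (Subtype.ext h)
  obtain ⟨d, hd, ⟨c, hc⟩, hsc⟩ :=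
    IsAlgebraic.exists_nonzero_dvd (R := D) (S := integralClosure D L)
      (s := ⟨(s : L), (hT _).1 s.2⟩) ((integralClosure.isIntegral _).isAlgebraic)
      (mem_nonZeroDivisors_of_ne_zero fun h => hs0 (congrArg Subtype.val h))
  have hdL : algebraMap K L d = s * c := congrArg Subtype.val hsc
  have hd0 : (d : K) ≠ 0 := fun h => hd (Subtype.ext h)
  have hxd : x * d ∈ D := by
    have : algebraMap K L (x * d) = a * c := by
      rw [map_mul, hdL, ← hx]
      change (a : L) / s * (s * c) = a * c
      field_simp
    refine hD.ge (Subring.mem_comap.2 ?_)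
    rw [this]
    exact mul_mem a.2 ((hT c).2 hc)
  exact ⟨⟨x * d, hxd⟩, d, (mul_div_cancel_right₀ x hd0).symm⟩

theorem isPvMD_of_integralClosure {Ω : Type*} [Field Ω] [Algebra K Ω] [Algebra L Ω]
    [IsScalarTower K L Ω] [Normal K Ω] [Normal L Ω] (B : Subring Ω) [IsIntegrallyClosedIn B Ω]
    (hB : ∀ (σ : Ω ≃ₐ[K] Ω) (x : Ω), x ∈ B → σ x ∈ B)
    [IsFractionRing (B.comap (algebraMap L Ω)) L] [IsFractionRing (B.comap (algebraMap K Ω)) K]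
    (h : IsPvMD (B.comap (algebraMap L Ω))) : IsPvMD (B.comap (algebraMap K Ω)) := by
  have : IsIntegrallyClosedIn (B.comap (algebraMap L Ω)) L := isIntegrallyClosedIn_comap B
  have : IsIntegrallyClosedIn (B.comap (algebraMap K Ω)) K := isIntegrallyClosedIn_comap B
  rw [isPvMD_iff _ L] at h
  rw [isPvMD_iff _ K]
  intro I hI hfg
  obtain ⟨f, rfl⟩ := exists_coeffSpan_eq hfg
  rw [coeffSpan_ne_bot] at hI
  have hfL : f.map (algebraMap K L) ≠ 0 := map_ne_zero hI
  obtain ⟨k, hk0, hk⟩ := IsTInvertible.exists_unitVContent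
    (h _ (coeffSpan_ne_bot.2 hfL) (coeffSpan_fg _))
  have hg := hk.map_algebraMap fun (σ : Ω ≃ₐ[L] Ω) x hx => hB (σ.restrictScalars K) x hx
  set g := (f.map (algebraMap K L) * k).map (algebraMap L Ω) with hg_def
  have hg0 : g ≠ 0 := map_ne_zero (mul_ne_zero hfL hk0)
  obtain ⟨s, hgs, q, hq, p, hp⟩ := exists_norm (K := K) g
  have hpΩ : UnitVContent B (p.map (algebraMap K Ω)) := by
    rw [hp]
    refine UnitVContent.pow (Multiset.prod_induction _ _ (fun _ _ => UnitVContent.mul)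
      (unitVContent_one B) fun r hr => ?_) q
    obtain ⟨σ, -, rfl⟩ := Multiset.mem_map.1 hr
    refine hg.map_equiv (σ : Ω ≃+* Ω) fun x => ⟨fun hx => ?_, hB σ x⟩
    simpa using hB σ.symm _ hx
  have hp0 : p ≠ 0 := by
    rintro rfl
    rw [Polynomial.map_zero] at hp
    have hz := Multiset.prod_eq_zero_iff.1 (eq_zero_of_pow_eq_zero hp.symm)
    obtain ⟨σ, -, hσ⟩ := Multiset.mem_map.1 hz
    exact map_ne_zero hg0 hσ
  have hdvd : f ∣ p := by
    rw [← map_dvd_map' (algebraMap K Ω), hp]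
    refine dvd_trans ?_ ((Multiset.dvd_prod hgs).trans (dvd_pow_self _ hq))
    rw [hg_def, Polynomial.map_mul, Polynomial.map_map, ← IsScalarTower.algebraMap_eq]
    exact dvd_mul_right _ _
  obtain ⟨m, rfl⟩ := hdvd
  exact hpΩ.of_map.isTInvertible hp0

end Descent

end PvMD

theorem mainTheorem10 {K L : Type*} [Field K] [Field L] [Algebra K L]
    (hKL : Algebra.IsAlgebraic K L)
    (T : Subring L) (hTL : IsFractionRing T L)
    (D : Subring K) (hD : D = T.comap (algebraMap K L))
    (hT : ∀ x : L, x ∈ T ↔ IsIntegral D x)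
    (hPvMD : PvMD.IsPvMD T) :
    PvMD.IsPvMD D := by
  let Ω := AlgebraicClosure L
  have : Algebra.IsAlgebraic K Ω := Algebra.IsAlgebraic.trans K L Ω
  have : IsAlgClosure K Ω := ⟨inferInstance, inferInstance⟩
  have : Normal K Ω := IsAlgClosure.normal K Ω
  have : IsScalarTower D L Ω := IsScalarTower.of_algebraMap_eq fun x =>
    IsScalarTower.algebraMap_apply K L Ω x
  have hDK : IsFractionRing D K := PvMD.isFractionRing_comap D T hD hT
  let B : Subring Ω := (integralClosure D Ω).toSubring
  have hBi : IsIntegrallyClosedIn B Ω :=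
    inferInstanceAs (IsIntegrallyClosedIn (integralClosure D Ω) Ω)
  have hTB : T = B.comap (algebraMap L Ω) := by
    ext x
    rw [hT]
    exact (isIntegral_algebraMap_iff (algebraMap L Ω).injective).symm
  have hDB : D = B.comap (algebraMap K Ω) := by
    conv_lhs => rw [hD, hTB]
    ext x
    simp [Subring.mem_comap, IsScalarTower.algebraMap_apply K L Ω x]
  have hB : ∀ (σ : Ω ≃ₐ[K] Ω) (x : Ω), x ∈ B → σ x ∈ B := fun σ x hx =>
    IsIntegral.map (σ.toAlgHom.restrictScalars D) hx
  clear_value B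
  subst hTB
  have h2 : IsFractionRing (B.comap (algebraMap K Ω)) K := hDB ▸ hDK
  rw [hDB]
  exact PvMD.isPvMD_of_integralClosure B hB hPvMD
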